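/- Consider the two-particle continuous time TASEP on $\mathbb{Z}$: two cars at positions $x_1(t)>x_2(t)$, $t\in\mathbb{R}_{\ge0}$, carry independent exponential clocks (that is, for each car the successive waiting times between rings are i.i.d. exponential with rate equal to the speed of the car, the two clocks being independent). When the clock of a car rings, the car jumps by $1$ to the right if the destination is not occupied by the other car; otherwise it does not move. Let $\alpha_0>\alpha_1>0$. In the fast-slow system (FS) the front car $x_1$ has speed $\alpha_0$ and the back car $x_2$ has speed $\alpha_1$; in the slow-fast system (SF) the front car has speed $\alpha_1$ and the back car has speed $\alpha_0$. Let $x_1^\circ>x_2^\circ$ be arbitrary integers. Let $\mathrm{FS}_{x_1^\circ,x_2^\circ}$ be the FS system started from $(x_1^\circ,x_2^\circ)$, and let $\mathrm{SF}_{y_1^\circ,x_2^\circ}$ be the SF system started from the random initial condition $(y_1^\circ,x_2^\circ)$, where $$y_1^\circ=x_2^\circ+1+\min\left(G,\;x_1^\circ-x_2^\circ-1\right)$$ and $G$ is a random variable independent of the clocks of the SF system with the geometric distribution $\mathbb{P}(G=k)=(1-\alpha_1/\alpha_0)(\alpha_1/\alpha_0)^k$, $k\in\mathbb{Z}_{\ge0}$.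 Then the whole trajectory $\{x_2(t)\}_{t\in\mathbb{R}_{\ge0}}$ of the back car has the same distribution in $\mathrm{FS}_{x_1^\circ,x_2^\circ}$ and in $\mathrm{SF}_{y_1^\circ,x_2^\circ}$, as a random element of the space of functions $\mathbb{R}_{\ge0}\to\mathbb{Z}$ with the product $\sigma$-algebra. -/

import Mathlib

open MeasureTheory ProbabilityTheory
open scoped NNReal

namespace TwoCars

/-- The time of the `k`-th ring (`k = 0, 1, 2, …`) of a clock whose successive waiting times are
`w 0, w 1, w 2, …`. -/
noncomputable def ringTime (w : ℕ → ℝ) (k : ℕ) : ℝ := ∑ j ∈ Finset.range (k + 1), w j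

/-- The number of rings during `[0, t]` (almost surely finite for exponential waiting times). -/
noncomputable def ringCount (w : ℕ → ℝ) (t : ℝ) : ℕ := Set.ncard {k : ℕ | ringTime w k ≤ t}

/-- The number of rings during `[0, t)`, that is, the left limit at `t` of the number of rings. -/
noncomputable def ringCountBefore (w : ℕ → ℝ) (t : ℝ) : ℕ := Set.ncard {k : ℕ | ringTime w k < t}

/-- The position at time `t` of the front car started from `x₁`: nothing is in front of it, so it
jumps by `1` at every ring of its clock `w₁`. -/
noncomputable def frontPos (x₁ : ℤ) (w₁ : ℕ → ℝ) (t : ℝ) : ℤ := x₁ + (ringCount w₁ t : ℤ)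

/-- The position of the front car immediately before time `t`, i.e. `x₁(t-)`. -/
noncomputable def frontPosBefore (x₁ : ℤ) (w₁ : ℕ → ℝ) (t : ℝ) : ℤ :=
  x₁ + (ringCountBefore w₁ t : ℤ)

/-- The position of the back car, started from `x₂`, after the first `n` rings of its clock `w₂`.
At each ring it jumps by `1` to the right, unless the destination is occupied by the front car. -/
noncomputable def backPosAfter (x₁ x₂ : ℤ) (w₁ w₂ : ℕ → ℝ) : ℕ → ℤ
  | 0 => x₂
  | k + 1 =>
    if backPosAfter x₁ x₂ w₁ w₂ k + 1 = frontPosBefore x₁ w₁ (ringTime w₂ k) then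
      backPosAfter x₁ x₂ w₁ w₂ k
    else
      backPosAfter x₁ x₂ w₁ w₂ k + 1

/-- The position of the back car at time `t`. -/
noncomputable def backPos (x₁ x₂ : ℤ) (w₁ w₂ : ℕ → ℝ) (t : ℝ) : ℤ :=
  backPosAfter x₁ x₂ w₁ w₂ (ringCount w₂ t)

/-- The trajectory `t ↦ (x₁(t), x₂(t))`, `t ≥ 0`, of the two-particle continuous time TASEP
(front car, back car) started from `(x₁, x₂)`. Here `w 0 0, w 0 1, …` are the waiting times of
the clock of the front car, and `w 1 0, w 1 1, …` those of the clock of the back car. -/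
noncomputable def tasep (x₁ x₂ : ℤ) (w : Fin 2 → ℕ → ℝ) (t : ℝ≥0) : ℤ × ℤ :=
  (frontPos x₁ (w 0) t, backPos x₁ x₂ (w 0) (w 1) t)

/-- `W` is a pair of independent exponential clocks on the probability space `(Ω, μ)`, of rate
`α₁` for the front car (index `0`) and of rate `α₂` for the back car (index `1`): all waiting
times are independent, those of a clock of rate `α` being exponential of rate `α`. -/
structure ExponentialClocks {Ω : Type*} [MeasurableSpace Ω] (μ : Measure Ω) (α₁ α₂ : ℝ)
    (W : Ω → Fin 2 → ℕ → ℝ) : Prop where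
  law_front : ∀ k, HasLaw (fun ω => W ω 0 k) (expMeasure α₁) μ
  law_back : ∀ k, HasLaw (fun ω => W ω 1 k) (expMeasure α₂) μ
  indep : iIndepFun (fun (p : Fin 2 × ℕ) ω => W ω p.1 p.2) μ

/-- `G` is a geometric random variable with parameter `r` on `{0, 1, 2, …}`:
`P(G = k) = (1 - r) r ^ k`. -/
structure IsGeometric {Ω : Type*} [MeasurableSpace Ω] (μ : Measure Ω) (r : ℝ) (G : Ω → ℕ) :
    Prop where
  aemeasurable : AEMeasurable G μ
  prob_eq : ∀ k : ℕ, μ {ω | G ω = k} = ENNReal.ofReal ((1 - r) * r ^ k)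

end TwoCars

namespace TwoCars

/-! ### Decomposing the pair of clocks at the first ring -/

/-! Only the gap between the cars matters, observed at the rings of the two clocks taken together.
By memorylessness (`lintegral_exp_residual`, `pairLaw_first_ring_le`), the first ring comes after an
exponential time of rate `α₀ + α₁`, independently of which clock rings, and leaves two fresh clocks
of the old rates. So in both systems the ring times have the same law, while the gap is a walk on
`ℕ` held at `0`: FS goes up with probability `p = α₀ / (α₀ + α₁)` and down with `q = α₁ / (α₀ +
α₁)`; SF has `p` and `q` exchanged. The back car moves exactly at the unblocked down steps.

The kernel sending `g` to the law of `min G g` intertwines the two walks, with the record of the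
back car's jumps included, because `q = p * r` for `r = α₁ / α₀` (`truncGeom_intertwining`).
Induction on the number of rings then equates the laws of the histories on boxes
(`pairLaw_history_eq_truncGeom`, `ext_of_boxes`). For almost all clocks the back trajectory is a
fixed measurable function of the history (`tasep_snd_eq_backPath`), so its law agrees as well. -/

/-- The sequence of waiting times `a, w 0, w 1, …`. -/
def consSeq (a : ℝ) (w : ℕ → ℝ) : ℕ → ℝ
  | 0 => a
  | n + 1 => w n

/-- The sequence of waiting times `w 1, w 2, …`. -/
def tailSeq (w : ℕ → ℝ) : ℕ → ℝ := fun n => w (n + 1)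

/-- The waiting times of the clock `w` seen from time `a` on, if it does not ring before. -/
def shorten (w : ℕ → ℝ) (a : ℝ) : ℕ → ℝ := consSeq (w 0 - a) (tailSeq w)

/-- The waiting times of the two clocks (front, back) seen from the first ring on. If both ring at
the same time, the ring of the back car counts as the first one. -/
noncomputable def nextClocks (s : (ℕ → ℝ) × (ℕ → ℝ)) : (ℕ → ℝ) × (ℕ → ℝ) :=
  if s.2 0 ≤ s.1 0 then (shorten s.1 (s.2 0), tailSeq s.2) else (tailSeq s.1, shorten s.2 (s.1 0))

/-- The number of empty sites between the cars after the first ring. -/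
noncomputable def nextGap (g : ℕ) (s : (ℕ → ℝ) × (ℕ → ℝ)) : ℕ :=
  if s.2 0 ≤ s.1 0 then g - 1 else g + 1

/-- The sequence of the times between successive rings of the two clocks, together with the
information whether the back car jumps at the ring, started with `g` empty sites between
the cars. -/
noncomputable def history (g : ℕ) (s : (ℕ → ℝ) × (ℕ → ℝ)) : ℕ → ℝ × Bool
  | 0 => (min (s.1 0) (s.2 0), decide (s.2 0 ≤ s.1 0 ∧ 0 < g))
  | n + 1 => history (nextGap g s) (nextClocks s) n

/-- The number of jumps of the back car up to time `t`, in terms of the history. -/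
noncomputable def jumpCount (o : ℕ → ℝ × Bool) (t : ℝ) : ENNReal :=
  ∑' i, if (o i).2 = true ∧ ∑ j ∈ Finset.range (i + 1), (o j).1 ≤ t then 1 else 0

/-- A clock with nonnegative waiting times that rings finitely often in bounded time. -/
structure RegularClock (w : ℕ → ℝ) : Prop where
  nonneg : ∀ k, 0 ≤ w k
  unbounded : ∀ t, ∃ k, t < ringTime w k

lemma ringTime_succ (w : ℕ → ℝ) (k : ℕ) : ringTime w (k + 1) = w 0 + ringTime (tailSeq w) k := by
  rw [ringTime, Finset.sum_range_succ', add_comm]; rfl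

lemma ringTime_zero (w : ℕ → ℝ) : ringTime w 0 = w 0 := by simp [ringTime]

lemma ringTime_shorten (w : ℕ → ℝ) (a : ℝ) (k : ℕ) : ringTime (shorten w a) k = ringTime w k - a := by
  cases k with
  | zero => simp [ringTime_zero, shorten, consSeq]
  | succ k =>
    rw [ringTime_succ, ringTime_succ]
    change w 0 - a + ringTime (tailSeq w) k = _
    ring

namespace RegularClock

variable {w : ℕ → ℝ}

lemma monotone_ringTime (h : RegularClock w) : Monotone (ringTime w) :=
  monotone_nat_of_le_succ fun k => by
    rw [ringTime, ringTime, Finset.sum_range_succ _ (k + 1)]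
    linarith [h.nonneg (k + 1)]

lemma le_ringTime (h : RegularClock w) (k : ℕ) : w 0 ≤ ringTime w k :=
  (ringTime_zero w).symm.le.trans (h.monotone_ringTime (Nat.zero_le k))

/-- `Set.ncard` is `0` on infinite sets, so this finiteness is what makes `ringCount` a genuine
count. -/
lemma finite_le (h : RegularClock w) (t : ℝ) : {k | ringTime w k ≤ t}.Finite := by
  obtain ⟨K, hK⟩ := h.unbounded t
  refine (Set.finite_Iio K).subset fun k hk => ?_
  by_contra hc
  exact absurd (h.monotone_ringTime (not_lt.1 hc)) (by simp only [Set.mem_ofPred_eq] at hk; linarith)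

lemma finite_lt (h : RegularClock w) (t : ℝ) : {k | ringTime w k < t}.Finite :=
  (h.finite_le t).subset fun k (hk : ringTime w k < t) => hk.le

lemma tailSeq (h : RegularClock w) : RegularClock (tailSeq w) where
  nonneg k := h.nonneg (k + 1)
  unbounded t := by
    obtain ⟨k, hk⟩ := h.unbounded (w 0 + t)
    refine ⟨k, ?_⟩
    have := h.monotone_ringTime (Nat.le_succ k)
    rw [Nat.succ_eq_add_one, ringTime_succ] at this
    linarith

lemma shorten (h : RegularClock w) {a : ℝ} (ha : a ≤ w 0) : RegularClock (shorten w a) where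
  nonneg k := by
    cases k with
    | zero => exact sub_nonneg.2 ha
    | succ k => exact h.nonneg (k + 1)
  unbounded t := by
    obtain ⟨k, hk⟩ := h.unbounded (t + a)
    exact ⟨k, by rw [ringTime_shorten]; linarith⟩

end RegularClock

lemma ringCount_shorten (w : ℕ → ℝ) (a t : ℝ) : ringCount (shorten w a) (t - a) = ringCount w t := by
  simp [ringCount, ringTime_shorten]

lemma ringCountBefore_shorten (w : ℕ → ℝ) (a t : ℝ) :
    ringCountBefore (shorten w a) (t - a) = ringCountBefore w t := by
  simp [ringCountBefore, ringTime_shorten]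

lemma ringCount_of_lt {w : ℕ → ℝ} (h : RegularClock w) {t : ℝ} (ht : t < w 0) :
    ringCount w t = 0 := by
  rw [ringCount, Set.ncard_eq_zero (h.finite_le t), Set.eq_empty_iff_forall_notMem]
  exact fun k hk => absurd (h.le_ringTime k) (by simp only [Set.mem_ofPred_eq] at hk; linarith)

lemma ringCountBefore_of_le {w : ℕ → ℝ} (h : RegularClock w) {t : ℝ} (ht : t ≤ w 0) :
    ringCountBefore w t = 0 := by
  rw [ringCountBefore, Set.ncard_eq_zero (h.finite_lt t), Set.eq_empty_iff_forall_notMem]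
  exact fun k hk => absurd (h.le_ringTime k) (by simp only [Set.mem_ofPred_eq] at hk; linarith)

lemma ncard_eq_ncard_succ_add_one {p : ℕ → Prop} (h0 : p 0) (hfin : {k | p (k + 1)}.Finite) :
    {k | p k}.ncard = {k | p (k + 1)}.ncard + 1 := by
  have : {k | p k} = insert 0 (Nat.succ '' {k | p (k + 1)}) := by
    ext k
    cases k <;> simp [h0]
  rw [this, Set.ncard_insert_of_notMem (by simp) (hfin.image _),
    Set.ncard_image_of_injective _ Nat.succ_injective]

lemma ringCount_of_le {w : ℕ → ℝ} (h : RegularClock w) {t : ℝ} (ht : w 0 ≤ t) :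
    ringCount w t = ringCount (tailSeq w) (t - w 0) + 1 := by
  have h1 : {k | ringTime w (k + 1) ≤ t} = {k | ringTime (tailSeq w) k ≤ t - w 0} := by
    ext k; simp [ringTime_succ, le_sub_iff_add_le, add_comm]
  rw [ringCount, ringCount, ← h1]
  exact ncard_eq_ncard_succ_add_one (p := fun k => ringTime w k ≤ t) (by rwa [ringTime_zero])
    (h1 ▸ h.tailSeq.finite_le _)

lemma ringCountBefore_of_lt {w : ℕ → ℝ} (h : RegularClock w) {t : ℝ} (ht : w 0 < t) :
    ringCountBefore w t = ringCountBefore (tailSeq w) (t - w 0) + 1 := by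
  have h1 : {k | ringTime w (k + 1) < t} = {k | ringTime (tailSeq w) k < t - w 0} := by
    ext k; simp [ringTime_succ, lt_sub_iff_add_lt, add_comm]
  rw [ringCountBefore, ringCountBefore, ← h1]
  exact ncard_eq_ncard_succ_add_one (p := fun k => ringTime w k < t) (by rwa [ringTime_zero])
    (h1 ▸ h.tailSeq.finite_lt _)

lemma frontPosBefore_shorten (x₁ : ℤ) (w : ℕ → ℝ) (a t : ℝ) :
    frontPosBefore x₁ (shorten w a) (t - a) = frontPosBefore x₁ w t := by
  rw [frontPosBefore, frontPosBefore, ringCountBefore_shorten]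

lemma frontPosBefore_of_lt (x₁ : ℤ) {w : ℕ → ℝ} (h : RegularClock w) {t : ℝ} (ht : w 0 < t) :
    frontPosBefore x₁ w t = frontPosBefore (x₁ + 1) (tailSeq w) (t - w 0) := by
  rw [frontPosBefore, frontPosBefore, ringCountBefore_of_lt h ht]
  push_cast; ring

/-- The system is restarted at the front car's first ring. Strictness matters: the back car sees the
front car's left limit, so a simultaneous ring would not yet count. -/
lemma backPosAfter_of_front_first (x₁ x₂ : ℤ) {w₁ w₂ : ℕ → ℝ} (h₁ : RegularClock w₁)
    (h₂ : RegularClock w₂) (h : w₁ 0 < w₂ 0) (k : ℕ) :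
    backPosAfter x₁ x₂ w₁ w₂ k =
      backPosAfter (x₁ + 1) x₂ (tailSeq w₁) (shorten w₂ (w₁ 0)) k := by
  induction k with
  | zero => rfl
  | succ k ih =>
    rw [backPosAfter, backPosAfter, ← ih, ringTime_shorten,
      frontPosBefore_of_lt x₁ h₁ (h.trans_le (h₂.le_ringTime k))]

/-- Up to and including a tie, the left limit of the front position is still `x₁` at the back car's
first ring. Hence the tie-breaking rule in `nextClocks`. -/
lemma backPosAfter_of_back_first (x₁ x₂ : ℤ) {w₁ w₂ : ℕ → ℝ} (h₁ : RegularClock w₁)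
    (h : w₂ 0 ≤ w₁ 0) (k : ℕ) :
    backPosAfter x₁ x₂ w₁ w₂ (k + 1) =
      backPosAfter x₁ (if x₂ + 1 = x₁ then x₂ else x₂ + 1) (shorten w₁ (w₂ 0)) (tailSeq w₂) k := by
  induction k with
  | zero => simp [backPosAfter, ringTime_zero, frontPosBefore, ringCountBefore_of_le h₁ h]
  | succ k ih =>
    rw [backPosAfter, ih, backPosAfter, ringTime_succ, ← frontPosBefore_shorten x₁ w₁ (w₂ 0),
      add_sub_cancel_left]

lemma jumpCount_eq (o : ℕ → ℝ × Bool) (t : ℝ) :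
    jumpCount o t = (if (o 0).2 = true ∧ (o 0).1 ≤ t then 1 else 0) +
      jumpCount (fun n => o (n + 1)) (t - (o 0).1) := by
  rw [jumpCount, tsum_eq_zero_add' ENNReal.summable]
  congr 1
  · simp
  · rw [jumpCount]
    refine tsum_congr fun i => ?_
    simp only [Finset.sum_range_succ' _ (i + 1), le_sub_iff_add_le]

lemma jumpCount_of_lt {o : ℕ → ℝ × Bool} (ho : ∀ n, 0 ≤ (o n).1) {t : ℝ} (ht : t < (o 0).1) :
    jumpCount o t = 0 := by
  rw [jumpCount, ENNReal.tsum_eq_zero]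
  refine fun i => if_neg fun hi => ?_
  have := Finset.single_le_sum (f := fun j => (o j).1) (fun j _ => ho j)
    (Finset.mem_range.2 (Nat.succ_pos i))
  linarith [hi.2]

lemma RegularClock.nextClocks {s : (ℕ → ℝ) × (ℕ → ℝ)} (h₁ : RegularClock s.1)
    (h₂ : RegularClock s.2) :
    RegularClock (nextClocks s).1 ∧ RegularClock (nextClocks s).2 := by
  unfold TwoCars.nextClocks
  split_ifs with h
  · exact ⟨h₁.shorten h, h₂.tailSeq⟩
  · exact ⟨h₁.tailSeq, h₂.shorten (le_of_not_ge h)⟩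

lemma history_nonneg (n : ℕ) : ∀ (g : ℕ) {s : (ℕ → ℝ) × (ℕ → ℝ)}, RegularClock s.1 →
    RegularClock s.2 → 0 ≤ (history g s n).1 := by
  induction n with
  | zero => exact fun g s h₁ h₂ => le_min (h₁.nonneg 0) (h₂.nonneg 0)
  | succ n ih => exact fun g s h₁ h₂ => ih _ (h₁.nextClocks h₂).1 (h₁.nextClocks h₂).2

/-- The trajectory of the back car is a function of the history. -/
lemma exists_backPos_eq_and_jumpCount_eq (N : ℕ) : ∀ (g : ℕ) (s : (ℕ → ℝ) × (ℕ → ℝ)) (x₂ : ℤ)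
    (t : ℝ), RegularClock s.1 → RegularClock s.2 → ringCount s.1 t + ringCount s.2 t = N →
    ∃ n : ℕ, backPos (x₂ + g + 1) x₂ s.1 s.2 t = x₂ + n ∧ jumpCount (history g s) t = n := by
  -- Restarting after the first ring lowers the total number of rings up to the (shifted) time by
  -- one.
  induction N with
  | zero =>
    intro g s x₂ t h₁ h₂ hN
    refine ⟨0, ?_, ?_⟩
    · rw [backPos, (Nat.add_eq_zero_iff.1 hN).2, backPosAfter]; simp
    · refine (jumpCount_of_lt (fun n => history_nonneg n g h₁ h₂) ?_).trans Nat.cast_zero.symm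
      change t < min (s.1 0) (s.2 0)
      by_contra hc
      rcases min_le_iff.1 (not_lt.1 hc) with h | h
      · rw [ringCount_of_le h₁ h] at hN; omega
      · rw [ringCount_of_le h₂ h] at hN; omega
  | succ N ih =>
    intro g s x₂ t h₁ h₂ hN
    have hn := h₁.nextClocks h₂
    rw [jumpCount_eq]
    change ∃ n : ℕ, _ ∧ (if decide (s.2 0 ≤ s.1 0 ∧ 0 < g) = true ∧ min (s.1 0) (s.2 0) ≤ t
      then 1 else 0) + jumpCount (history (nextGap g s) (nextClocks s))
        (t - min (s.1 0) (s.2 0)) = n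
    by_cases h : s.2 0 ≤ s.1 0
    · have hnext : nextClocks s = (shorten s.1 (s.2 0), tailSeq s.2) := if_pos h
      have hgap : nextGap g s = g - 1 := if_pos h
      rw [min_eq_right h]
      have ht : s.2 0 ≤ t := by
        by_contra hc
        rw [not_le] at hc
        rw [ringCount_of_lt h₁ (hc.trans_le h), ringCount_of_lt h₂ hc] at hN
        omega
      obtain ⟨n, hpos, hcount⟩ := ih (nextGap g s) (nextClocks s)
        (if x₂ + 1 = x₂ + g + 1 then x₂ else x₂ + 1) (t - s.2 0) hn.1 hn.2 (by
          rw [hnext, ringCount_shorten]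
          rw [ringCount_of_le h₂ ht] at hN
          dsimp only
          omega)
      rw [hcount, backPos, ringCount_of_le h₂ ht, backPosAfter_of_back_first _ _ h₁ h]
      rw [hnext, backPos] at hpos
      rw [hgap] at hpos
      -- At gap `0` the jump is blocked, and truncated subtraction keeps the gap at `0`.
      rcases Nat.eq_zero_or_pos g with rfl | hg
      · refine ⟨n, ?_, by simp⟩
        simpa using hpos
      · refine ⟨n + 1, ?_, by simp [h, hg, ht, add_comm]⟩
        have hne : ¬ x₂ + 1 = x₂ + (g : ℤ) + 1 := by omega
        rw [if_neg hne] at hpos ⊢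
        have : x₂ + 1 + ((g - 1 : ℕ) : ℤ) + 1 = x₂ + g + 1 := by omega
        rw [this] at hpos
        rw [hpos]
        push_cast; ring
    · have hnext : nextClocks s = (tailSeq s.1, shorten s.2 (s.1 0)) := if_neg h
      have hgap : nextGap g s = g + 1 := if_neg h
      have h' := not_le.1 h
      rw [min_eq_left h'.le]
      have ht : s.1 0 ≤ t := by
        by_contra hc
        rw [not_le] at hc
        rw [ringCount_of_lt h₁ hc, ringCount_of_lt h₂ (hc.trans h')] at hN
        omega
      obtain ⟨n, hpos, hcount⟩ := ih (nextGap g s) (nextClocks s) x₂ (t - s.1 0) hn.1 hn.2 (by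
          rw [hnext, ringCount_shorten]
          rw [ringCount_of_le h₁ ht] at hN
          dsimp only
          omega)
      refine ⟨n, ?_, by rw [hcount]; simp [h]⟩
      rw [hnext, backPos, ringCount_shorten, hgap] at hpos
      rw [backPos, backPosAfter_of_front_first _ _ h₁ h₂ h', ← hpos]
      congr 1
      push_cast; ring

/-- The trajectory of the back car started from `x₂`, in terms of the history. -/
noncomputable def backPath (x₂ : ℤ) (o : ℕ → ℝ × Bool) (t : ℝ≥0) : ℤ :=
  -- For regular clocks the count is a natural number and the floor is exact; an infinite count gets
  -- the default `0`.
  x₂ + ⌊(jumpCount o t).toReal⌋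

lemma tasep_snd_eq_backPath (g : ℕ) (x₂ : ℤ) {w : Fin 2 → ℕ → ℝ} (h : ∀ i, RegularClock (w i)) :
    (fun t => (tasep (x₂ + g + 1) x₂ w t).2) = backPath x₂ (history g (w 0, w 1)) := by
  funext t
  obtain ⟨n, h1, h2⟩ := exists_backPos_eq_and_jumpCount_eq _ g (w 0, w 1) x₂ t (h 0) (h 1) rfl
  rw [backPath, h2]
  simpa [tasep] using h1

/-! ### Measurability -/

lemma measurable_consSeq : Measurable fun p : ℝ × (ℕ → ℝ) => consSeq p.1 p.2 := by
  refine measurable_pi_lambda _ fun n => ?_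
  cases n with
  | zero => exact measurable_fst
  | succ n => exact (measurable_pi_apply n).comp measurable_snd

lemma measurable_tailSeq : Measurable tailSeq :=
  measurable_pi_lambda _ fun n => measurable_pi_apply (n + 1)

lemma measurable_shorten : Measurable fun p : (ℕ → ℝ) × ℝ => shorten p.1 p.2 := by
  refine measurable_consSeq.comp (Measurable.prodMk ?_ (measurable_tailSeq.comp measurable_fst))
  fun_prop

lemma measurableSet_back_first : MeasurableSet {s : (ℕ → ℝ) × (ℕ → ℝ) | s.2 0 ≤ s.1 0} :=
  measurableSet_le (by fun_prop) (by fun_prop)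

lemma measurable_nextClocks : Measurable nextClocks := by
  refine Measurable.ite measurableSet_back_first ?_ ?_
  · exact (measurable_shorten.comp (f := fun s : (ℕ → ℝ) × (ℕ → ℝ) => (s.1, s.2 0))
      (by fun_prop)).prodMk (measurable_tailSeq.comp measurable_snd)
  · exact (measurable_tailSeq.comp measurable_fst).prodMk
      (measurable_shorten.comp (f := fun s : (ℕ → ℝ) × (ℕ → ℝ) => (s.2, s.1 0)) (by fun_prop))

lemma measurable_nextGap (g : ℕ) : Measurable (nextGap g) :=
  Measurable.ite measurableSet_back_first measurable_const measurable_const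

lemma measurable_history_apply (n : ℕ) :
    Measurable fun p : ℕ × ((ℕ → ℝ) × (ℕ → ℝ)) => history p.1 p.2 n := by
  induction n with
  | zero =>
    refine measurable_from_prod_countable_right fun g => ?_
    refine Measurable.prodMk (by fun_prop) ?_
    refine measurable_to_bool ?_
    have : (fun s : (ℕ → ℝ) × (ℕ → ℝ) => decide (s.2 0 ≤ s.1 0 ∧ 0 < g)) ⁻¹' {true} =
      {s | s.2 0 ≤ s.1 0} ∩ {_s | 0 < g} := by ext; simp
    change MeasurableSet ((fun s : (ℕ → ℝ) × (ℕ → ℝ) => decide (s.2 0 ≤ s.1 0 ∧ 0 < g)) ⁻¹' {true})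
    rw [this]
    exact measurableSet_back_first.inter (MeasurableSet.const _)
  | succ n ih =>
    refine measurable_from_prod_countable_right fun g => ?_
    exact ih.comp ((measurable_nextGap g).prodMk measurable_nextClocks)

lemma measurable_history : Measurable fun p : ℕ × ((ℕ → ℝ) × (ℕ → ℝ)) => history p.1 p.2 :=
  measurable_pi_lambda _ measurable_history_apply

lemma measurable_jumpCount (t : ℝ) : Measurable fun o => jumpCount o t := by
  refine Measurable.tsum fun i => Measurable.ite ?_ measurable_const measurable_const
  refine MeasurableSet.inter ?_ ?_
  · exact (measurableSet_singleton true).preimage (measurable_snd.comp (measurable_pi_apply i))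
  · have h : Measurable fun o : ℕ → ℝ × Bool => ∑ j ∈ Finset.range (i + 1), (o j).1 := by fun_prop
    exact measurableSet_le h measurable_const

lemma measurable_backPath (x₂ : ℤ) : Measurable (backPath x₂) := by
  refine measurable_pi_lambda _ fun t => ?_
  exact measurable_const.add ((measurable_jumpCount t).ennreal_toReal.floor)

/-! ### The law of the clocks -/

/-- The law of the waiting times of an exponential clock of rate `r`. -/
noncomputable def clockLaw (r : ℝ) : Measure (ℕ → ℝ) := Measure.infinitePi fun _ => expMeasure r

lemma isProbabilityMeasure_clockLaw {r : ℝ} (hr : 0 < r) : IsProbabilityMeasure (clockLaw r) := by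
  have := isProbabilityMeasure_expMeasure hr
  unfold clockLaw
  infer_instance

lemma expMeasure_eq_withDensity (r : ℝ) :
    expMeasure r = volume.withDensity (exponentialPDF r) := rfl

lemma measurable_exponentialPDF (r : ℝ) : Measurable (exponentialPDF r) :=
  (measurable_exponentialPDFReal r).ennreal_ofReal

lemma lintegral_expMeasure (r : ℝ) {f : ℝ → ENNReal} (hf : Measurable f) :
    ∫⁻ x, f x ∂expMeasure r = ∫⁻ x, exponentialPDF r x * f x := by
  rw [expMeasure_eq_withDensity,
    lintegral_withDensity_eq_lintegral_mul _ (measurable_exponentialPDF r) hf]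
  rfl

lemma expMeasure_singleton (r x : ℝ) : expMeasure r {x} = 0 :=
  withDensity_absolutelyContinuous _ _ (measure_singleton x)

/-- An infinite product of copies of `m` is obtained by prepending an independent coordinate. -/
lemma map_consSeq (m : Measure ℝ) [IsProbabilityMeasure m] :
    (m.prod (Measure.infinitePi fun _ : ℕ => m)).map (fun p => consSeq p.1 p.2) =
      Measure.infinitePi fun _ : ℕ => m := by
  refine Measure.eq_infinitePi _ fun s t ht => ?_
  classical
  have hpre : (fun p : ℝ × (ℕ → ℝ) => consSeq p.1 p.2) ⁻¹' (s : Set ℕ).pi t =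
      (if 0 ∈ s then t 0 else Set.univ) ×ˢ
        ((s.preimage Nat.succ Nat.succ_injective.injOn : Finset ℕ) : Set ℕ).pi
          fun n => t (n + 1) := by
    ext ⟨a, u⟩
    simp only [Set.mem_preimage, Set.mem_pi, Finset.mem_coe, Set.mem_prod, Finset.mem_preimage]
    constructor
    · refine fun h => ⟨?_, fun n hn => h (n + 1) hn⟩
      split_ifs with h0
      · exact h 0 h0
      · trivial
    · rintro ⟨h0, h1⟩ (_ | n) hn
      · rwa [if_pos hn] at h0
      · exact h1 n hn
  rw [Measure.map_apply measurable_consSeq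
    (MeasurableSet.pi s.countable_toSet fun i _ => ht i), hpre, Measure.prod_prod,
    Measure.infinitePi_pi _ fun i _ => ht (i + 1)]
  rw [Finset.prod_preimage' Nat.succ s Nat.succ_injective.injOn (fun n => m (t n))]
  by_cases h0 : 0 ∈ s
  · rw [if_pos h0, ← Finset.mul_prod_erase s _ h0]
    congr 1
    refine Finset.prod_congr ?_ fun _ _ => rfl
    ext n
    cases n <;> simp
  · rw [if_neg h0, measure_univ, one_mul]
    refine Finset.prod_congr ?_ fun _ _ => rfl
    ext n
    cases n <;> simp [h0]

lemma lintegral_clockLaw {r : ℝ} (hr : 0 < r) {f : (ℕ → ℝ) → ENNReal} (hf : Measurable f) :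
    ∫⁻ w, f w ∂clockLaw r = ∫⁻ a, ∫⁻ u, f (consSeq a u) ∂clockLaw r ∂expMeasure r := by
  have := isProbabilityMeasure_expMeasure hr
  have := isProbabilityMeasure_clockLaw hr
  conv_lhs => rw [clockLaw, ← map_consSeq, ← clockLaw]
  rw [lintegral_map hf measurable_consSeq,
    lintegral_prod (fun p : ℝ × (ℕ → ℝ) => f (consSeq p.1 p.2))
      (hf.comp measurable_consSeq).aemeasurable]

open scoped Classical in
/-- Memorylessness: on the event that the clock of rate `α` rings first, the time of the ring is
exponential of rate `α + β` and the residual waiting time of the other clock is exponential of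
rate `β`. -/
lemma lintegral_exp_residual {α β : ℝ} (hα : 0 < α) (hβ : 0 < β) {A : Set ℝ} (hA : MeasurableSet A)
    {H : ℝ → ENNReal} (hH : Measurable H) :
    ∫⁻ a, ∫⁻ b, (if a ≤ b ∧ a ∈ A then H (b - a) else 0) ∂expMeasure β ∂expMeasure α =
      ENNReal.ofReal (α / (α + β)) * expMeasure (α + β) A * ∫⁻ c, H c ∂expMeasure β := by
  have hmeas : Measurable fun p : ℝ × ℝ => if p.1 ≤ p.2 ∧ p.1 ∈ A then H (p.2 - p.1) else 0 := by
    refine Measurable.ite ?_ (hH.comp (measurable_snd.sub measurable_fst)) measurable_const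
    exact (measurableSet_le measurable_fst measurable_snd).inter (measurable_fst hA)
  have := isProbabilityMeasure_expMeasure hβ
  have inner (a : ℝ) (ha : 0 ≤ a) :
      ∫⁻ b, (if a ≤ b ∧ a ∈ A then H (b - a) else 0) ∂expMeasure β =
        ENNReal.ofReal (Real.exp (-(β * a))) * A.indicator 1 a * ∫⁻ c, H c ∂expMeasure β := by
    rw [lintegral_expMeasure β (f := fun b => if a ≤ b ∧ a ∈ A then H (b - a) else 0)
        (hmeas.comp (measurable_prodMk_left (x := a))),
      lintegral_expMeasure _ hH, ← lintegral_const_mul (f := fun c => exponentialPDF β c * H c) _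
        ((measurable_exponentialPDF β).mul hH),
      -- Substitute `b = c + a`; the density at `c + a` is `exp (-(β * a))` times the density at
      -- `c`.
      ← lintegral_add_right_eq_self _ a]
    refine lintegral_congr fun c => ?_
    by_cases haA : a ∈ A
    · rcases lt_or_ge c 0 with hc | hc
      · rw [exponentialPDF_of_neg hc, if_neg (by rintro ⟨h, -⟩; linarith)]
        simp
      · rw [if_pos ⟨by linarith, haA⟩, exponentialPDF_of_nonneg hc,
          exponentialPDF_of_nonneg (by linarith), Set.indicator_of_mem haA, add_sub_cancel_right,
          Pi.one_apply, mul_one, ← mul_assoc, ← ENNReal.ofReal_mul (Real.exp_pos _).le]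
        congr 2
        rw [mul_left_comm, ← Real.exp_add]
        ring_nf
    · simp [haA]
  rw [lintegral_expMeasure _ hmeas.lintegral_prod_right', ← lintegral_indicator_one hA,
    lintegral_expMeasure _ (measurable_one.indicator hA), mul_assoc, ← lintegral_mul_const,
    ← lintegral_const_mul]
  · refine lintegral_congr fun a => ?_
    rcases lt_or_ge a 0 with ha | ha
    · simp [exponentialPDF_of_neg ha]
    · rw [inner a ha, exponentialPDF_of_nonneg ha, exponentialPDF_of_nonneg ha]
      simp only [← mul_assoc]
      rw [← ENNReal.ofReal_mul (by positivity), ← ENNReal.ofReal_mul (by positivity)]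
      -- The constant comes from `α e^{-αa} e^{-βa} = (α / (α + β)) · (α + β) e^{-(α + β)a}`.
      congr 3
      have : α + β ≠ 0 := by positivity
      field_simp
      rw [← Real.exp_add]
      ring_nf
  · exact (((measurable_exponentialPDF _).mul (measurable_one.indicator hA)).mul_const _)
  · exact ((measurable_exponentialPDF _).mul (measurable_one.indicator hA))

/-- The joint law of two independent exponential clocks of rates `α` and `β`. -/
noncomputable def pairLaw (α β : ℝ) : Measure ((ℕ → ℝ) × (ℕ → ℝ)) :=
  (clockLaw α).prod (clockLaw β)

lemma isProbabilityMeasure_pairLaw {α β : ℝ} (hα : 0 < α) (hβ : 0 < β) :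
    IsProbabilityMeasure (pairLaw α β) := by
  have := isProbabilityMeasure_clockLaw hα
  have := isProbabilityMeasure_clockLaw hβ
  unfold pairLaw
  infer_instance

/-- The two first waiting times are put outermost, so that `lintegral_exp_residual` can be applied
to them. -/
lemma lintegral_pairLaw {α β : ℝ} (hα : 0 < α) (hβ : 0 < β)
    {f : (ℕ → ℝ) × (ℕ → ℝ) → ENNReal} (hf : Measurable f) :
    ∫⁻ s, f s ∂pairLaw α β = ∫⁻ a, ∫⁻ b, ∫⁻ u, ∫⁻ v, f (consSeq a u, consSeq b v)
      ∂clockLaw β ∂clockLaw α ∂expMeasure β ∂expMeasure α := by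
  have := isProbabilityMeasure_clockLaw hα
  have := isProbabilityMeasure_clockLaw hβ
  have := isProbabilityMeasure_expMeasure hα
  have := isProbabilityMeasure_expMeasure hβ
  rw [pairLaw, lintegral_prod _ hf.aemeasurable,
    lintegral_clockLaw hα hf.lintegral_prod_right']
  refine lintegral_congr fun a => ?_
  have hm : Measurable fun p : ((ℕ → ℝ) × ℝ) × (ℕ → ℝ) =>
      f (consSeq a p.1.1, consSeq p.1.2 p.2) := by
    refine hf.comp (Measurable.prodMk ?_ ?_)
    · exact measurable_consSeq.comp
        (f := fun p : ((ℕ → ℝ) × ℝ) × (ℕ → ℝ) => (a, p.1.1)) (by fun_prop)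
    · exact measurable_consSeq.comp
        (f := fun p : ((ℕ → ℝ) × ℝ) × (ℕ → ℝ) => (p.1.2, p.2)) (by fun_prop)
  rw [← lintegral_lintegral_swap (μ := clockLaw α) (ν := expMeasure β)
    (f := fun u b => ∫⁻ v, f (consSeq a u, consSeq b v) ∂clockLaw β)
    hm.lintegral_prod_right'.aemeasurable]
  exact lintegral_congr fun u => lintegral_clockLaw hβ (hf.comp measurable_prodMk_left)

/-- One step of the pair of clocks, on the event that the first clock rings first. -/
lemma pairLaw_first_ring_le {α β : ℝ} (hα : 0 < α) (hβ : 0 < β) {A : Set ℝ} (hA : MeasurableSet A)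
    {C : Set ((ℕ → ℝ) × (ℕ → ℝ))} (hC : MeasurableSet C) :
    pairLaw α β {s | s.1 0 ≤ s.2 0 ∧ s.1 0 ∈ A ∧ (tailSeq s.1, shorten s.2 (s.1 0)) ∈ C} =
      ENNReal.ofReal (α / (α + β)) * expMeasure (α + β) A * pairLaw α β C := by
  have := isProbabilityMeasure_clockLaw hα
  have := isProbabilityMeasure_clockLaw hβ
  have := isProbabilityMeasure_expMeasure hβ
  have hS : MeasurableSet {s : (ℕ → ℝ) × (ℕ → ℝ) |
      s.1 0 ≤ s.2 0 ∧ s.1 0 ∈ A ∧ (tailSeq s.1, shorten s.2 (s.1 0)) ∈ C} := by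
    refine (measurableSet_le ((measurable_pi_apply 0).comp measurable_fst)
      ((measurable_pi_apply 0).comp measurable_snd)).inter (MeasurableSet.inter ?_ ?_)
    · exact (measurable_pi_apply 0).comp measurable_fst hA
    · exact ((measurable_tailSeq.comp measurable_fst).prodMk
        (measurable_shorten.comp (f := fun s : (ℕ → ℝ) × (ℕ → ℝ) => (s.2, s.1 0))
          (by fun_prop))) hC
  set H : ℝ → ENNReal := fun c => ∫⁻ u, ∫⁻ v, C.indicator 1 (u, consSeq c v)
    ∂clockLaw β ∂clockLaw α with hH
  have hCm : Measurable (C.indicator (1 : (ℕ → ℝ) × (ℕ → ℝ) → ENNReal)) :=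
    measurable_one.indicator hC
  have hm : Measurable fun p : (ℝ × (ℕ → ℝ)) × (ℕ → ℝ) =>
      C.indicator (1 : (ℕ → ℝ) × (ℕ → ℝ) → ENNReal) (p.1.2, consSeq p.1.1 p.2) := by
    refine hCm.comp (Measurable.prodMk (by fun_prop) ?_)
    exact measurable_consSeq.comp
      (f := fun p : (ℝ × (ℕ → ℝ)) × (ℕ → ℝ) => (p.1.1, p.2)) (by fun_prop)
  have hHm : Measurable H := hm.lintegral_prod_right'.lintegral_prod_right'
  have hHint : ∫⁻ c, H c ∂expMeasure β = pairLaw α β C := by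
    rw [← lintegral_indicator_one hC, pairLaw, lintegral_prod _ hCm.aemeasurable, hH,
      lintegral_lintegral_swap (μ := expMeasure β) (ν := clockLaw α)
        (f := fun c u => ∫⁻ v, C.indicator 1 (u, consSeq c v) ∂clockLaw β)
        hm.lintegral_prod_right'.aemeasurable]
    exact lintegral_congr fun u =>
      (lintegral_clockLaw hβ (hCm.comp measurable_prodMk_left)).symm
  rw [← hHint, ← lintegral_exp_residual hα hβ hA hHm, ← lintegral_indicator_one hS,
    lintegral_pairLaw hα hβ (measurable_one.indicator hS)]
  refine lintegral_congr fun a => lintegral_congr fun b => ?_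
  by_cases hab : a ≤ b ∧ a ∈ A
  · rw [if_pos hab]
    refine lintegral_congr fun u => lintegral_congr fun v => ?_
    refine Set.indicator_eq_indicator ?_ rfl
    exact ⟨fun h => h.2.2, fun h => ⟨hab.1, hab.2, h⟩⟩
  · rw [if_neg hab, lintegral_eq_zero_of_ae_eq_zero]
    refine Filter.Eventually.of_forall fun u => ?_
    refine (lintegral_congr fun v => ?_).trans lintegral_zero
    exact Set.indicator_of_notMem (fun h => hab ⟨h.1, h.2.1⟩) _

/-- With the first clock fixed, a tie asks an exponential variable to hit a given point. Ties being
null, the tie-breaking convention does not affect the law. -/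
lemma pairLaw_eq_zero {α β : ℝ} (hα : 0 < α) (hβ : 0 < β) :
    pairLaw α β {s | s.1 0 = s.2 0} = 0 := by
  have := isProbabilityMeasure_clockLaw hα
  have := isProbabilityMeasure_clockLaw hβ
  have := isProbabilityMeasure_expMeasure hβ
  rw [pairLaw, Measure.measure_prod_null (measurableSet_eq_fun (by fun_prop) (by fun_prop))]
  refine Filter.Eventually.of_forall fun u => ?_
  have : (Prod.mk u ⁻¹' {s : (ℕ → ℝ) × (ℕ → ℝ) | s.1 0 = s.2 0}) =
      (fun w : ℕ → ℝ => w 0) ⁻¹' {u 0} := by ext w; simp [eq_comm]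
  simp only [this, Pi.zero_apply]
  rw [← Measure.map_apply (by fun_prop) (measurableSet_singleton _), clockLaw,
    Measure.infinitePi_map_eval (fun _ : ℕ => expMeasure β) 0, expMeasure_singleton]

lemma pairLaw_front_first {α β : ℝ} (hα : 0 < α) (hβ : 0 < β) {A : Set ℝ} (hA : MeasurableSet A)
    {C : Set ((ℕ → ℝ) × (ℕ → ℝ))} (hC : MeasurableSet C) :
    pairLaw α β {s | ¬ s.2 0 ≤ s.1 0 ∧ min (s.1 0) (s.2 0) ∈ A ∧ nextClocks s ∈ C} =
      ENNReal.ofReal (α / (α + β)) * expMeasure (α + β) A * pairLaw α β C := by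
  rw [← pairLaw_first_ring_le hα hβ hA hC]
  have hne : ∀ᵐ s ∂pairLaw α β, s.1 0 ≠ s.2 0 := by
    simpa [ae_iff] using pairLaw_eq_zero hα hβ
  refine measure_congr ?_
  filter_upwards [hne] with s hs
  refine propext ?_
  change ¬ s.2 0 ≤ s.1 0 ∧ min (s.1 0) (s.2 0) ∈ A ∧ nextClocks s ∈ C ↔
    s.1 0 ≤ s.2 0 ∧ s.1 0 ∈ A ∧ (tailSeq s.1, shorten s.2 (s.1 0)) ∈ C
  by_cases h : s.2 0 ≤ s.1 0
  · simp only [h, not_true_eq_false, false_and, false_iff]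
    exact fun h' => hs (le_antisymm h'.1 h)
  · simp [h, le_of_not_ge h, nextClocks]

lemma pairLaw_back_first {α β : ℝ} (hα : 0 < α) (hβ : 0 < β) {A : Set ℝ} (hA : MeasurableSet A)
    {C : Set ((ℕ → ℝ) × (ℕ → ℝ))} (hC : MeasurableSet C) :
    pairLaw α β {s | s.2 0 ≤ s.1 0 ∧ min (s.1 0) (s.2 0) ∈ A ∧ nextClocks s ∈ C} =
      ENNReal.ofReal (β / (α + β)) * expMeasure (α + β) A * pairLaw α β C := by
  have := isProbabilityMeasure_clockLaw hα
  have := isProbabilityMeasure_clockLaw hβ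
  have hswap : ∀ S : Set ((ℕ → ℝ) × (ℕ → ℝ)),
      pairLaw α β S = pairLaw β α (Prod.swap ⁻¹' S) := by
    intro S
    rw [pairLaw, ← Measure.prod_swap]
    exact (MeasurableEquiv.prodComm).map_apply S
  rw [hswap, hswap C, add_comm α β, ← pairLaw_first_ring_le hβ hα hA (measurable_swap hC)]
  congr 1
  ext s
  change s.1 0 ≤ s.2 0 ∧ min (s.2 0) (s.1 0) ∈ A ∧ nextClocks s.swap ∈ C ↔
    s.1 0 ≤ s.2 0 ∧ s.1 0 ∈ A ∧ (shorten s.2 (s.1 0), tailSeq s.1) ∈ C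
  refine and_congr_right fun h => ?_
  rw [min_eq_right h, nextClocks, if_pos (by exact h)]
  rfl

/-! ### The intertwining relation -/

/-- The mean of `u (min G g)` for a geometric random variable `G` with `P(G = k) = c * r ^ k`. -/
noncomputable def truncGeom (c r : ENNReal) : ℕ → (ℕ → ENNReal) → ENNReal
  | 0, u => u 0
  | g + 1, u => c * u 0 + r * truncGeom c r g (fun h => u (h + 1))

lemma truncGeom_const {c r : ENNReal} (hcr : c + r = 1) (a : ENNReal) (g : ℕ) :
    truncGeom c r g (fun _ => a) = a := by
  induction g with
  | zero => rfl
  | succ g ih => rw [truncGeom, ih, ← add_mul, hcr, one_mul]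

lemma truncGeom_linear (c r a b : ENNReal) (g : ℕ) : ∀ u v : ℕ → ENNReal,
    truncGeom c r g (fun h => a * u h + b * v h) =
      a * truncGeom c r g u + b * truncGeom c r g v := by
  induction g with
  | zero => exact fun _ _ => rfl
  | succ g ih =>
    intro u v
    rw [truncGeom, ih, truncGeom, truncGeom]
    ring

/-- Here `a` and `b` weigh a ring without and with a jump of the back car. The `b` terms agree since
`min G g` is positive with probability `r`, and then `min G g - 1` has the law of `min G (g - 1)`;
so `p * r = q` is exactly what is needed. For positive `g` the rest is algebra; `c + r = 1` enters
only at `g = 0`, where both `u 0` terms come from blocked or upward rings of weight `a`. -/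
lemma truncGeom_intertwining {c r p q : ENNReal} (hcr : c + r = 1) (hq : q = p * r)
    (a b : ENNReal) (u : ℕ → ENNReal) (g : ℕ) :
    p * a * truncGeom c r (g + 1) u + q * (if 0 < g then b else a) * truncGeom c r (g - 1) u =
      truncGeom c r g
        (fun h => q * a * u (h + 1) + p * (if 0 < h then b else a) * u (h - 1)) := by
  subst hq
  cases g with
  | zero =>
    simp only [truncGeom, lt_irrefl, if_false, zero_add, Nat.zero_sub]
    calc p * a * (c * u 0 + r * u 1) + p * r * a * u 0
        = p * r * a * u 1 + p * a * ((c + r) * u 0) := by ring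
      _ = _ := by rw [hcr, one_mul]
  | succ g =>
    rw [truncGeom, truncGeom, truncGeom]
    simp only [Nat.succ_pos, if_true, lt_irrefl, if_false, Nat.add_sub_cancel, truncGeom_linear,
      zero_add, Nat.zero_sub]
    ring

/-- The recursion of `truncGeom` is the memorylessness of `G`: it is `0` with probability `1 - r`,
and otherwise `G - 1` is again geometric. -/
lemma tsum_geometric_min {r : ℝ} (h0 : 0 < r) (h1 : r < 1) (g : ℕ) : ∀ u : ℕ → ENNReal,
    ∑' k, ENNReal.ofReal ((1 - r) * r ^ k) * u (min k g) =
      truncGeom (ENNReal.ofReal (1 - r)) (ENNReal.ofReal r) g u := by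
  induction g with
  | zero =>
    intro u
    simp only [Nat.min_zero, truncGeom]
    rw [ENNReal.tsum_mul_right, ← ENNReal.ofReal_tsum_of_nonneg
      (fun k => mul_nonneg (sub_nonneg.2 h1.le) (by positivity))
      ((summable_geometric_of_lt_one h0.le h1).mul_left _), tsum_mul_left,
      tsum_geometric_of_lt_one h0.le h1, mul_inv_cancel₀ (sub_pos.2 h1).ne', ENNReal.ofReal_one,
      one_mul]
  | succ g ih =>
    intro u
    rw [tsum_eq_zero_add' ENNReal.summable, truncGeom, ← ih, ← ENNReal.tsum_mul_left]
    congr 1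
    · simp
    · refine tsum_congr fun k => ?_
      rw [← mul_assoc, ← ENNReal.ofReal_mul h0.le, Nat.add_min_add_right]
      ring_nf

/-! ### The law of the history -/

lemma measurableSet_history {n : ℕ} {B : ℕ → Set (ℝ × Bool)} (hB : ∀ i, MeasurableSet (B i))
    (g : ℕ) : MeasurableSet {s | ∀ i < n, history g s i ∈ B i} := by
  simp only [Set.ofPred_forall]
  refine MeasurableSet.iInter fun i => MeasurableSet.iInter fun _ => ?_
  exact ((measurable_history_apply i).comp measurable_prodMk_left) (hB i)

/-- Conditioning the history on the first ring. -/
lemma pairLaw_history_succ {α β : ℝ} (hα : 0 < α) (hβ : 0 < β) (n : ℕ) {B : ℕ → Set (ℝ × Bool)}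
    (hB : ∀ i, MeasurableSet (B i)) (g : ℕ) :
    pairLaw α β {s | ∀ i < n + 1, history g s i ∈ B i} =
      ENNReal.ofReal (α / (α + β)) * expMeasure (α + β) ((fun x => (x, false)) ⁻¹' B 0) *
        pairLaw α β {s | ∀ i < n, history (g + 1) s i ∈ B (i + 1)} +
      ENNReal.ofReal (β / (α + β)) *
        (if 0 < g then expMeasure (α + β) ((fun x => (x, true)) ⁻¹' B 0)
          else expMeasure (α + β) ((fun x => (x, false)) ⁻¹' B 0)) *
        pairLaw α β {s | ∀ i < n, history (g - 1) s i ∈ B (i + 1)} := by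
  have hif : (if 0 < g then expMeasure (α + β) ((fun x => (x, true)) ⁻¹' B 0)
      else expMeasure (α + β) ((fun x => (x, false)) ⁻¹' B 0)) =
      expMeasure (α + β) ((fun x => (x, decide (0 < g))) ⁻¹' B 0) := by
    by_cases hg : 0 < g <;> simp [hg]
  have hpair (b : Bool) : MeasurableSet ((fun x : ℝ => (x, b)) ⁻¹' B 0) :=
    measurable_prodMk_right (hB 0)
  rw [hif, ← pairLaw_front_first hα hβ (hpair false) (measurableSet_history (fun i => hB (i + 1)) _),
    ← pairLaw_back_first hα hβ (hpair _) (measurableSet_history (fun i => hB (i + 1)) _),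
    ← measure_inter_add_sdiff _ measurableSet_back_first, add_comm]
  congr 2
  · ext s
    change ((∀ i < n + 1, history g s i ∈ B i) ∧ ¬ s.2 0 ≤ s.1 0) ↔ ¬ s.2 0 ≤ s.1 0 ∧
      (min (s.1 0) (s.2 0), false) ∈ B 0 ∧
        ∀ i < n, history (g + 1) (nextClocks s) i ∈ B (i + 1)
    rw [and_comm, Nat.forall_lt_succ_left']
    refine and_congr_right fun h => ?_
    simp [history, h, nextGap]
  · ext s
    change ((∀ i < n + 1, history g s i ∈ B i) ∧ s.2 0 ≤ s.1 0) ↔ s.2 0 ≤ s.1 0 ∧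
      (min (s.1 0) (s.2 0), decide (0 < g)) ∈ B 0 ∧
        ∀ i < n, history (g - 1) (nextClocks s) i ∈ B (i + 1)
    rw [and_comm, Nat.forall_lt_succ_left']
    refine and_congr_right fun h => ?_
    simp [history, h, nextGap]

/-- The law of the history in the fast-slow system is a mixture of the laws of the history in the
slow-fast system. -/
lemma pairLaw_history_eq_truncGeom {α₀ α₁ : ℝ} (hα₁ : 0 < α₁) (hα : α₁ < α₀) (n : ℕ) :
    ∀ (B : ℕ → Set (ℝ × Bool)), (∀ i, MeasurableSet (B i)) → ∀ g : ℕ,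
    pairLaw α₀ α₁ {s | ∀ i < n, history g s i ∈ B i} =
      truncGeom (ENNReal.ofReal (1 - α₁ / α₀)) (ENNReal.ofReal (α₁ / α₀)) g
        fun h => pairLaw α₁ α₀ {s | ∀ i < n, history h s i ∈ B i} := by
  have hα₀ : 0 < α₀ := hα₁.trans hα
  have := isProbabilityMeasure_pairLaw hα₀ hα₁
  have := isProbabilityMeasure_pairLaw hα₁ hα₀
  have hcr : ENNReal.ofReal (1 - α₁ / α₀) + ENNReal.ofReal (α₁ / α₀) = 1 := by
    rw [← ENNReal.ofReal_add (sub_nonneg.2 ((div_le_one hα₀).2 hα.le)) (by positivity)]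
    simp
  have hq : ENNReal.ofReal (α₁ / (α₀ + α₁)) =
      ENNReal.ofReal (α₀ / (α₀ + α₁)) * ENNReal.ofReal (α₁ / α₀) := by
    rw [← ENNReal.ofReal_mul (by positivity)]
    congr 1
    field_simp
  induction n with
  | zero => simp [truncGeom_const hcr]
  | succ n ih =>
    intro B hB g
    have ih' := ih (fun i => B (i + 1)) fun i => hB (i + 1)
    simp only [pairLaw_history_succ hα₀ hα₁ n hB, pairLaw_history_succ hα₁ hα₀ n hB, ih',
      add_comm α₁ α₀]
    exact truncGeom_intertwining hcr hq _ _ _ g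

/-- A probability measure on sequences is determined by its values on boxes. -/
lemma ext_of_boxes {X : Type*} [MeasurableSpace X] {μ ν : Measure (ℕ → X)} [IsProbabilityMeasure μ]
    [IsProbabilityMeasure ν]
    (h : ∀ (n : ℕ) (B : ℕ → Set X), (∀ i, MeasurableSet (B i)) →
      μ {o | ∀ i < n, o i ∈ B i} = ν {o | ∀ i < n, o i ∈ B i}) : μ = ν := by
  refine ext_of_generate_finite _ generateFrom_squareCylinders.symm
    (isPiSystem_squareCylinders (fun _ => MeasurableSpace.isPiSystem_measurableSet)
      fun _ => MeasurableSet.univ) ?_ (by simp)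
  rintro _ ⟨s, t, ht, rfl⟩
  classical
  have hs : (s : Set ℕ).pi t =
      {o | ∀ i < s.sup id + 1, o i ∈ if i ∈ s then t i else Set.univ} := by
    ext o
    refine ⟨fun ho i _ => ?_, fun ho i hi => ?_⟩
    · split_ifs with hi
      · exact ho i hi
      · trivial
    · have := ho i (Nat.lt_succ_of_le (Finset.le_sup (f := id) hi))
      rwa [if_pos (Finset.mem_coe.1 hi)] at this
  rw [hs]
  refine h _ _ fun i => ?_
  split_ifs
  · exact ht i trivial
  · exact MeasurableSet.univ

/-! ### Regularity of exponential clocks -/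

lemma ae_nonneg_expMeasure (r : ℝ) : ∀ᵐ x ∂expMeasure r, 0 ≤ x := by
  rw [expMeasure_eq_withDensity, ae_withDensity_iff (measurable_exponentialPDF r)]
  refine Filter.Eventually.of_forall fun x hx => ?_
  by_contra h
  exact hx (exponentialPDF_of_neg (not_le.1 h))

lemma expMeasure_Ioi_ne_zero {r : ℝ} (hr : 0 < r) : expMeasure r (Set.Ioi 1) ≠ 0 := by
  have := isProbabilityMeasure_expMeasure hr
  intro h
  have h1 : expMeasure r (Set.Iic 1) = 1 := by
    rwa [← prob_compl_eq_zero_iff measurableSet_Iic, Set.compl_Iic]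
  rw [expMeasure_eq_withDensity, withDensity_apply _ measurableSet_Iic,
    lintegral_exponentialPDF_eq_antiDeriv hr, if_pos zero_le_one, ENNReal.ofReal_eq_one] at h1
  linarith [Real.exp_pos (-(r * 1))]

/-- By the second Borel–Cantelli lemma, infinitely many waiting times exceed `1`. -/
lemma ae_regularClock {r : ℝ} (hr : 0 < r) : ∀ᵐ w ∂clockLaw r, RegularClock w := by
  have := isProbabilityMeasure_expMeasure hr
  have := isProbabilityMeasure_clockLaw hr
  have hnonneg : ∀ᵐ w ∂clockLaw r, ∀ k, 0 ≤ w k := by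
    refine ae_all_iff.2 fun k => ?_
    refine ae_of_ae_map (f := fun w : ℕ → ℝ => w k) (measurable_pi_apply k).aemeasurable
      (p := fun x => 0 ≤ x) ?_
    rw [clockLaw, Measure.infinitePi_map_eval (fun _ : ℕ => expMeasure r) k]
    exact ae_nonneg_expMeasure r
  have hbox (s : Finset ℕ) : clockLaw r (⋂ k ∈ s, {w | 1 < w k}) =
      ∏ k ∈ s, expMeasure r (Set.Ioi 1) := by
    rw [← Measure.infinitePi_pi (fun _ : ℕ => expMeasure r) (s := s) (t := fun _ => Set.Ioi 1)
      fun _ _ => measurableSet_Ioi, ← clockLaw]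
    congr 1
    ext w
    simp
  have hone (k : ℕ) : clockLaw r {w | 1 < w k} = expMeasure r (Set.Ioi 1) := by
    simpa using hbox {k}
  have hmeas (k : ℕ) : MeasurableSet {w : ℕ → ℝ | 1 < w k} :=
    measurableSet_lt measurable_const (measurable_pi_apply k)
  have hlim := measure_limsup_eq_one (μ := clockLaw r) hmeas
    ((iIndepSet_iff_meas_biInter hmeas).2 fun s => by simp only [hbox, hone])
    (by simp only [hone]; exact ENNReal.tsum_const_eq_top_of_ne_zero (expMeasure_Ioi_ne_zero hr))
  have hfreq : ∀ᵐ w ∂clockLaw r, w ∈ Filter.limsup (fun k => {w : ℕ → ℝ | 1 < w k}) Filter.atTop :=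
    (prob_compl_eq_zero_iff (MeasurableSet.measurableSet_limsup hmeas)).2 hlim
  filter_upwards [hnonneg, hfreq] with w h0 hw
  rw [Filter.mem_limsup_iff_frequently_mem] at hw
  refine ⟨h0, fun t => ?_⟩
  by_contra! hc
  -- Bounded ring times would make the waiting times summable, hence eventually below `1`.
  have hsum : Summable w := summable_of_sum_range_le h0 fun n =>
    (Finset.sum_le_sum_of_subset_of_nonneg (Finset.range_mono (Nat.le_succ n))
      fun i _ _ => h0 i).trans (hc n)
  refine hw ((hsum.tendsto_atTop_zero.eventually_lt_const zero_lt_one).mono fun k hk => ?_)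
  exact not_lt.2 hk.le

lemma ae_regularClock_pairLaw {α β : ℝ} (hα : 0 < α) (hβ : 0 < β) :
    ∀ᵐ s ∂pairLaw α β, RegularClock s.1 ∧ RegularClock s.2 := by
  have := isProbabilityMeasure_clockLaw hα
  have := isProbabilityMeasure_clockLaw hβ
  exact (Measure.quasiMeasurePreserving_fst.ae (ae_regularClock hα)).and
    (Measure.quasiMeasurePreserving_snd.ae (ae_regularClock hβ))

/-! ### The law of the trajectory of the back car -/

section Law

variable {Ω : Type*} [MeasurableSpace Ω] {μ : Measure Ω} {α β : ℝ} {W : Ω → Fin 2 → ℕ → ℝ}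

lemma ExponentialClocks.aemeasurable (hW : ExponentialClocks μ α β W) : AEMeasurable W μ := by
  refine aemeasurable_pi_lambda _ fun i => aemeasurable_pi_lambda _ fun k => ?_
  fin_cases i
  · exact (hW.law_front k).aemeasurable
  · exact (hW.law_back k).aemeasurable

lemma measurable_clockPair : Measurable fun w : Fin 2 → ℕ → ℝ => (w 0, w 1) := by
  fun_prop

/-- Joint independence gives a product law over `Fin 2 × ℕ`; currying turns it into a product of two
clock laws. -/
lemma ExponentialClocks.map_eq_pairLaw (hW : ExponentialClocks μ α β W) (hα : 0 < α) (hβ : 0 < β) :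
    μ.map (fun ω => (W ω 0, W ω 1)) = pairLaw α β := by
  have h (i : Fin 2) : IsProbabilityMeasure (expMeasure (![α, β] i)) := by
    fin_cases i
    · exact isProbabilityMeasure_expMeasure hα
    · exact isProbabilityMeasure_expMeasure hβ
  have hlaw (p : Fin 2 × ℕ) :
      HasLaw (fun ω => W ω p.1 p.2) (expMeasure (![α, β] p.1)) μ := by
    obtain ⟨i, k⟩ := p
    fin_cases i
    · exact hW.law_front k
    · exact hW.law_back k
  have hm : AEMeasurable (fun ω (p : Fin 2 × ℕ) => W ω p.1 p.2) μ :=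
    aemeasurable_pi_lambda _ fun p => (hlaw p).aemeasurable
  have h1 := (hW.indep.hasLaw_infinitePi hlaw hm).map_eq
  have h2 := Measure.infinitePi_map_curry fun (i : Fin 2) (_ : ℕ) => expMeasure (![α, β] i)
  rw [← h1, AEMeasurable.map_map_of_aemeasurable (by fun_prop) hm] at h2
  have := isProbabilityMeasure_clockLaw hα
  have := isProbabilityMeasure_clockLaw hβ
  have h3 := Measure.infinitePi_map_eval_prod
    (P := fun i : Fin 2 => Measure.infinitePi fun _ : ℕ => expMeasure (![α, β] i)) zero_ne_one
  rw [← h2, AEMeasurable.map_map_of_aemeasurable measurable_clockPair.aemeasurable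
    ((MeasurableEquiv.measurable _).comp_aemeasurable hm)] at h3
  exact h3

lemma ExponentialClocks.aemeasurable_pair (hW : ExponentialClocks μ α β W) :
    AEMeasurable (fun ω => (W ω 0, W ω 1)) μ :=
  measurable_clockPair.comp_aemeasurable hW.aemeasurable

lemma ExponentialClocks.ae_regularClock (hW : ExponentialClocks μ α β W) (hα : 0 < α)
    (hβ : 0 < β) : ∀ᵐ ω ∂μ, ∀ i, RegularClock (W ω i) := by
  have h := ae_of_ae_map hW.aemeasurable_pair
    (hW.map_eq_pairLaw hα hβ ▸ ae_regularClock_pairLaw hα hβ)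
  filter_upwards [h] with ω hω
  exact Fin.forall_fin_two.2 hω

/-- The law of the history started from the random gap `min G D`. -/
lemma map_history_min_apply [IsProbabilityMeasure μ] (hW : ExponentialClocks μ α β W) (hα : 0 < α)
    (hβ : 0 < β) {r : ℝ} {G : Ω → ℕ} (hG : IsGeometric μ r G) (hGW : IndepFun G W μ)
    (D : ℕ) {S : Set (ℕ → ℝ × Bool)} (hS : MeasurableSet S) :
    μ.map (fun ω => history (min (G ω) D) (W ω 0, W ω 1)) S =
      ∑' k, ENNReal.ofReal ((1 - r) * r ^ k) *
        pairLaw α β (history (min k D) ⁻¹' S) := by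
  have := isProbabilityMeasure_pairLaw hα hβ
  have hind : IndepFun G (fun ω => (W ω 0, W ω 1)) μ :=
    hGW.comp measurable_id measurable_clockPair
  have hjoint := (indepFun_iff_map_prod_eq_prod_map_map hG.aemeasurable
    hW.aemeasurable_pair).1 hind
  rw [hW.map_eq_pairLaw hα hβ] at hjoint
  have hF : Measurable fun p : ℕ × ((ℕ → ℝ) × (ℕ → ℝ)) => history (min p.1 D) p.2 :=
    measurable_history.comp
      (f := fun p : ℕ × ((ℕ → ℝ) × (ℕ → ℝ)) => (min p.1 D, p.2)) (by fun_prop)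
  have hcomp := AEMeasurable.map_map_of_aemeasurable hF.aemeasurable
    (hG.aemeasurable.prodMk hW.aemeasurable_pair)
  rw [hjoint] at hcomp
  change μ.map ((fun p : ℕ × ((ℕ → ℝ) × (ℕ → ℝ)) => history (min p.1 D) p.2) ∘
    fun ω => (G ω, (W ω 0, W ω 1))) S = _
  rw [← hcomp, Measure.map_apply hF hS, Measure.prod_apply (hF hS), lintegral_countable']
  refine tsum_congr fun k => ?_
  rw [Measure.map_apply_of_aemeasurable hG.aemeasurable (measurableSet_singleton k), mul_comm]
  congr 1
  exact hG.prob_eq k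

end Law

end TwoCars

open TwoCars in
theorem mainTheorem8 {α₀ α₁ : ℝ} (hα₁ : 0 < α₁) (hα : α₁ < α₀)
    {x₁ x₂ : ℤ} (hx : x₂ < x₁)
    -- the FS system: the front car has speed `α₀`, the back car has speed `α₁`
    {Ω : Type*} [MeasurableSpace Ω] (μ : Measure Ω) [IsProbabilityMeasure μ]
    (W : Ω → Fin 2 → ℕ → ℝ) (hW : TwoCars.ExponentialClocks μ α₀ α₁ W)
    -- the SF system: the front car has speed `α₁`, the back car has speed `α₀`,
    -- and `G` enters the initial position of the front car
    {Ω' : Type*} [MeasurableSpace Ω'] (ν : Measure Ω') [IsProbabilityMeasure ν]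
    (V : Ω' → Fin 2 → ℕ → ℝ) (hV : TwoCars.ExponentialClocks ν α₁ α₀ V)
    (G : Ω' → ℕ) (hG : TwoCars.IsGeometric ν (α₁ / α₀) G) (hGV : IndepFun G V ν) :
    -- the trajectories of the back car, as random elements of the path space, have the same law
    IdentDistrib
      (fun ω (t : ℝ≥0) => (TwoCars.tasep x₁ x₂ (W ω) t).2)
      (fun ω (t : ℝ≥0) => (TwoCars.tasep (x₂ + 1 + min (G ω : ℤ) (x₁ - x₂ - 1)) x₂ (V ω) t).2)
      μ ν := by
  have hα₀ : 0 < α₀ := hα₁.trans hα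
  -- `D` is the initial number of empty sites between the cars in FS; in SF it is `min G D`.
  obtain ⟨D, hD⟩ := Int.eq_ofNat_of_zero_le (show 0 ≤ x₁ - x₂ - 1 by omega)
  have hFS : (fun ω (t : ℝ≥0) => (tasep x₁ x₂ (W ω) t).2) =ᵐ[μ]
      fun ω => backPath x₂ (history D (W ω 0, W ω 1)) := by
    filter_upwards [hW.ae_regularClock hα₀ hα₁] with ω hω
    rw [← tasep_snd_eq_backPath D x₂ hω, show x₂ + (D : ℤ) + 1 = x₁ by omega]
  have hSF : (fun ω (t : ℝ≥0) =>
      (tasep (x₂ + 1 + min (G ω : ℤ) (x₁ - x₂ - 1)) x₂ (V ω) t).2) =ᵐ[ν]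
      fun ω => backPath x₂ (history (min (G ω) D) (V ω 0, V ω 1)) := by
    filter_upwards [hV.ae_regularClock hα₁ hα₀] with ω hω
    rw [← tasep_snd_eq_backPath (min (G ω) D) x₂ hω, hD,
      show x₂ + ((min (G ω) D : ℕ) : ℤ) + 1 = x₂ + 1 + min (G ω : ℤ) (D : ℤ) by omega]
  have hmFS : AEMeasurable (fun ω => history D (W ω 0, W ω 1)) μ :=
    (measurable_history.comp measurable_prodMk_left).comp_aemeasurable hW.aemeasurable_pair
  have hmSF : AEMeasurable (fun ω => history (min (G ω) D) (V ω 0, V ω 1)) ν :=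
    measurable_history.comp_aemeasurable
      (((measurable_of_countable fun k : ℕ => min k D).comp_aemeasurable hG.aemeasurable).prodMk
        hV.aemeasurable_pair)
  have hlaw : IdentDistrib (fun ω => history D (W ω 0, W ω 1))
      (fun ω => history (min (G ω) D) (V ω 0, V ω 1)) μ ν := by
    refine ⟨hmFS, hmSF, ?_⟩
    have := Measure.isProbabilityMeasure_map hmFS
    have := Measure.isProbabilityMeasure_map hmSF
    refine ext_of_boxes fun n B hB => ?_
    have hS : MeasurableSet {o : ℕ → ℝ × Bool | ∀ i < n, o i ∈ B i} := by
      simp only [Set.ofPred_forall]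
      exact MeasurableSet.iInter fun i => MeasurableSet.iInter fun _ => measurable_pi_apply i (hB i)
    have hD' : Measurable (history D) := measurable_history.comp measurable_prodMk_left
    have hcomp := AEMeasurable.map_map_of_aemeasurable hD'.aemeasurable hW.aemeasurable_pair
    rw [hW.map_eq_pairLaw hα₀ hα₁] at hcomp
    rw [map_history_min_apply hV hα₁ hα₀ hG hGV D hS]
    change μ.map (history D ∘ fun ω => (W ω 0, W ω 1)) _ = _
    rw [← hcomp, Measure.map_apply hD' hS]
    refine (pairLaw_history_eq_truncGeom hα₁ hα n B hB D).trans ?_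
    exact (tsum_geometric_min (div_pos hα₁ hα₀) ((div_lt_one hα₀).2 hα) D _).symm
  have hpath := hlaw.comp (measurable_backPath x₂)
  exact ((IdentDistrib.of_ae_eq (hpath.aemeasurable_fst.congr hFS.symm) hFS).trans hpath).trans
    (IdentDistrib.of_ae_eq (hpath.aemeasurable_snd.congr hSF.symm) hSF).symm
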